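/- Let $M,N\ge 1$ be integers, $A\in\mathbb{R}^{M\times N}$, $b\in\mathbb{R}^M$, $\beta>0$, $1\le q<\infty$, let $\mathrm{J}$ be a finite index set and $\{G_i\}_{i\in\mathrm{J}}\subset\mathbb{R}^N$, and assume that $Ax=0$ and $G_i^\top x=0$ for all $i\in\mathrm{J}$ imply $x=0$. Let $\phi:[0,\infty)\to[0,\infty)$ be continuous and concave with $\phi(0)=0$ and $\phi(t)\to\infty$ as $t\to\infty$, and $C^1$ on $(0,\infty)$ with $\phi'>0$ there and $\phi'(t)\to+\infty$ as $t\to0^+$, and let $\phi'$ be Lipschitz continuous on $[\alpha,\infty)$ for every $\alpha>0$. Put $$\mathcal F(x)=\sum_{i\in\mathrm{J}}\phi(|G_i^\top x|)+\frac{\beta}{q}\|Ax-b\|_q^q,\qquad x\in\mathbb{R}^N .$$ For $f:\mathbb{R}^N\to\mathbb{R}\cup\{+\infty\}$ and $y$ with $f(y)<\infty$, let $\widehat\partial f(y)$ be the set of all $v$ with $\liminf_{z\to y,\,z\ne y}\frac{f(z)-f(y)-\langle v,z-y\rangle}{\|z-y\|_2}\ge0$, and let the limiting subdifferential $\partial f(y)$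 be the set of all limits of sequences $s^k\in\widehat\partial f(y^k)$ with $y^k\to y$ and $f(y^k)\to f(y)$; if $f(y)=\infty$, both sets are empty. A point $y$ is a stationary point of $f$ if $0\in\partial f(y)$. A real-valued lower semicontinuous function $f$ is a Kurdyka–Łojasiewicz (KL) function if for every $y$ with $\partial f(y)\neq\emptyset$ there are $\eta\in(0,\infty]$, a neighbourhood $U$ of $y$ and a continuous concave function $\psi:[0,\eta)\to[0,\infty)$ with $\psi(0)=0$, $C^1$ on $(0,\eta)$ with $\psi'>0$ there, such that $\psi'(f(x)-f(y))\,\mathrm{dist}(0,\partial f(x))\ge1$ for all $x\in U$ with $f(y)<f(x)<f(y)+\eta$ (where $\mathrm{dist}(0,\emptyset)=+\infty$). Let $\rho>0$, $\tau\ge0$, $0<\epsilon<1$ and $x^0\in\mathbb{R}^N$, and let $\{x^k\}_{k\ge0}$ be any sequence generated by the inexact iterative thresholding and support-shrinking algorithm with proximal linearization, run without a limit on the number of iterations. That is, for each $k\ge0$, put $\mathrm{T}^k=\{i\in\mathrm{J}:|G_i^\top x^k|>\tau\}$ and $C_k^\tau=\{x:G_i^\top x=0\ \ \forall i\in\mathrm{J}\setminus\mathrm{T}^k\}$,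 let $\kappa_{C_k^\tau}$ be $0$ on $C_k^\tau$ and $+\infty$ elsewhere, and put $$\mathcal H_k^\tau(x)=\sum_{i\in\mathrm{T}^k}\Big\{\phi(|G_i^\top x^k|)+\phi'(|G_i^\top x^k|)\big(|G_i^\top x|-|G_i^\top x^k|\big)\Big\}+\frac{\beta}{q}\|Ax-b\|_q^q+\frac{\rho}{2}\|x-x^k\|_2^2 ;$$ then there is $h^{k+1}\in\partial\big(\mathcal H_k^\tau+\kappa_{C_k^\tau}\big)(x^{k+1})$ with $\|h^{k+1}\|_2\le\frac{\rho}{2}\epsilon\,\|x^{k+1}-x^k\|_2$. If $\mathcal F$ is a KL function, then the whole sequence $\{x^k\}$ converges to a stationary point of $\mathcal F$. -/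

import Mathlib

open Filter Topology Set

noncomputable section

namespace ITSS

/-! ### Subdifferentials of extended-real-valued functions -/

section Subdifferential

variable {E : Type*} [NormedAddCommGroup E] [InnerProductSpace ℝ E]

/-- The regular subdifferential of `f` at `y`. It is empty outside the domain `{f < ⊤}`; at a point
of the domain, `v` belongs to it iff
`liminf_{z → y, z ≠ y} (f z - f y - ⟪v, z - y⟫) / ‖z - y‖ ≥ 0`,
which is spelled out here as: for each `ε > 0`, one has
`f z ≥ f y + ⟪v, z - y⟫ - ε ‖z - y‖` for all `z` near `y`. -/
def regularSubdiff (f : E → EReal) (y : E) : Set E :=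
  {v | f y < ⊤ ∧ ∀ ε : ℝ, 0 < ε → ∀ᶠ z in 𝓝 y,
    f y + ((inner ℝ v (z - y) - ε * ‖z - y‖ : ℝ) : EReal) ≤ f z}

/-- The limiting subdifferential of `f` at `y` (empty outside the domain of `f`). -/
def limitingSubdiff (f : E → EReal) (y : E) : Set E :=
  {v | f y < ⊤ ∧ ∃ (u s : ℕ → E),
    Tendsto u atTop (𝓝 y) ∧ Tendsto (fun k => f (u k)) atTop (𝓝 (f y)) ∧
    (∀ k, s k ∈ regularSubdiff f (u k)) ∧ Tendsto s atTop (𝓝 v)}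

/-- The indicator function `κ_C`: zero on `C` and `+∞` elsewhere. -/
def indicatorFun (C : Set E) (x : E) : EReal :=
  open Classical in if x ∈ C then 0 else ⊤

/-- `y` is a stationary point of the real-valued function `f`. -/
def IsStationaryPoint (f : E → ℝ) (y : E) : Prop :=
  (0 : E) ∈ limitingSubdiff (fun x => (f x : EReal)) y

/-- The Kurdyka–Łojasiewicz property of a real-valued function `f` at `y`: there are `η > 0`, a
neighbourhood `U` of `y` and a continuous concave desingularizing function `ψ : [0, η) → [0, ∞)`
with `ψ 0 = 0`, of class `C¹` with positive derivative on `(0, η)`, such that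
`ψ' (f x - f y) * dist (0, ∂f x) ≥ 1` for all `x ∈ U` with `f y < f x < f y + η`
(the distance to the empty set being `+∞`, so that the inequality has to be checked on the elements
of `∂f x`). Since `η` may be decreased, it is no restriction to take it finite. -/
def HasKLPropertyAt (f : E → ℝ) (y : E) : Prop :=
  ∃ (η : ℝ) (U : Set E) (ψ : ℝ → ℝ),
    0 < η ∧ U ∈ 𝓝 y ∧
    ContinuousOn ψ (Ico 0 η) ∧ ConcaveOn ℝ (Ico 0 η) ψ ∧ ψ 0 = 0 ∧
    (∀ t ∈ Ico 0 η, 0 ≤ ψ t) ∧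
    ContDiffOn ℝ 1 ψ (Ioo 0 η) ∧ (∀ t ∈ Ioo 0 η, 0 < deriv ψ t) ∧
    ∀ x ∈ U, f y < f x → f x < f y + η →
      ∀ v ∈ limitingSubdiff (fun z => (f z : EReal)) x, 1 ≤ deriv ψ (f x - f y) * ‖v‖

/-- A (real-valued, lower semicontinuous) Kurdyka–Łojasiewicz function: the KL property holds at
every point of the domain of the limiting subdifferential. -/
def IsKLFunction (f : E → ℝ) : Prop :=
  LowerSemicontinuous f ∧
    ∀ y, (limitingSubdiff (fun x => (f x : EReal)) y).Nonempty → HasKLPropertyAt f y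

end Subdifferential

/-! ### The model and the algorithm -/

/-- The standing assumptions on the potential function `φ : [0, ∞) → [0, ∞)`, which is represented
by a function on `ℝ` of which only the values on `[0, ∞)` matter. -/
structure IsPotential (φ : ℝ → ℝ) : Prop where
  nonneg : ∀ t, 0 ≤ t → 0 ≤ φ t
  continuousOn : ContinuousOn φ (Ici 0)
  concaveOn : ConcaveOn ℝ (Ici 0) φ
  coercive : Tendsto φ atTop atTop
  map_zero : φ 0 = 0
  contDiffOn : ContDiffOn ℝ 1 φ (Ioi 0)
  deriv_pos : ∀ t, 0 < t → 0 < deriv φ t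
  deriv_zero_right : Tendsto (deriv φ) (𝓝[>] 0) atTop
  deriv_lipschitz : ∀ α, 0 < α → ∃ L : ℝ, ∀ t s, α ≤ t → α ≤ s →
    |deriv φ t - deriv φ s| ≤ L * |t - s|

section Model

variable {M N : ℕ} {J : Type*} [Fintype J]

/-- The fidelity term `(β / q) ‖A x - b‖_q ^ q`. -/
def fidelity (A : Matrix (Fin M) (Fin N) ℝ) (b : EuclideanSpace ℝ (Fin M)) (β q : ℝ)
    (x : EuclideanSpace ℝ (Fin N)) : ℝ :=
  β / q * ∑ l, |A.mulVec x.ofLp l - b l| ^ q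

/-- The objective `F x = ∑_{i ∈ J} φ |G_iᵀ x| + (β / q) ‖A x - b‖_q ^ q`. -/
def objective (φ : ℝ → ℝ) (G : J → EuclideanSpace ℝ (Fin N)) (A : Matrix (Fin M) (Fin N) ℝ)
    (b : EuclideanSpace ℝ (Fin M)) (β q : ℝ) (x : EuclideanSpace ℝ (Fin N)) : ℝ :=
  ∑ i, φ |inner ℝ (G i) x| + fidelity A b β q x

/-- The `τ`-support `T(y) = {i : |G_iᵀ y| > τ}`. -/
def tauSupport (G : J → EuclideanSpace ℝ (Fin N)) (τ : ℝ) (y : EuclideanSpace ℝ (Fin N)) :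
    Finset J :=
  {i | |inner ℝ (G i) y| > τ}

/-- The subspace `{x : G_iᵀ x = 0 for all i ∉ T(y)}` to which the next iterate is constrained. -/
def constraintSet (G : J → EuclideanSpace ℝ (Fin N)) (τ : ℝ) (y : EuclideanSpace ℝ (Fin N)) :
    Set (EuclideanSpace ℝ (Fin N)) :=
  {x | ∀ i, i ∉ tauSupport G τ y → inner ℝ (G i) x = 0}

/-- The objective of the proximally linearized subproblem at the current iterate `y`. -/
def linearized (φ : ℝ → ℝ) (G : J → EuclideanSpace ℝ (Fin N)) (A : Matrix (Fin M) (Fin N) ℝ)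
    (b : EuclideanSpace ℝ (Fin M)) (β q ρ τ : ℝ) (y x : EuclideanSpace ℝ (Fin N)) : ℝ :=
  ∑ i ∈ tauSupport G τ y,
      (φ |inner ℝ (G i) y| +
        deriv φ |inner ℝ (G i) y| * (|inner ℝ (G i) x| - |inner ℝ (G i) y|))
    + fidelity A b β q x + ρ / 2 * ‖x - y‖ ^ 2

/-- `x` is a sequence of iterates of the inexact iterative thresholding and support-shrinking
algorithm with proximal linearization, run without a bound on the number of iterations and from an
arbitrary starting point `x 0`: each `x (k + 1)` solves the `k`-th subproblem up to a subgradient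
`h` of norm at most `(ρ / 2) ε ‖x (k + 1) - x k‖`. -/
def IsInexactITSSPL (φ : ℝ → ℝ) (G : J → EuclideanSpace ℝ (Fin N))
    (A : Matrix (Fin M) (Fin N) ℝ) (b : EuclideanSpace ℝ (Fin M)) (β q ρ τ ε : ℝ)
    (x : ℕ → EuclideanSpace ℝ (Fin N)) : Prop :=
  ∀ k, ∃ h ∈ limitingSubdiff
      (fun z => (linearized φ G A b β q ρ τ (x k) z : EReal)
        + indicatorFun (constraintSet G τ (x k)) z) (x (k + 1)),
    ‖h‖ ≤ ρ / 2 * ε * ‖x (k + 1) - x k‖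

end Model

end ITSS

end

open ITSS

/-!
The iterates can only lose support: a component of `(Gᵢᵀ xᵏ)ᵢ` that is at most `τ` is set to zero
and stays zero. Since there are finitely many components, the support is eventually constant, and
from then on all iterates live in one subspace, on which the algorithm is a majorization scheme.

In this regime the tangent inequality for the concave `φ` shows that the linearized subproblem
majorizes the objective with a gap `ρ / 2 * ‖z - y‖ ^ 2`. Since the subproblem is convex, its limiting
subgradients are subgradients of convex analysis (`subgradient_of_mem_limitingSubdiff`), and
testing with the old iterate gives sufficient decrease (`objective_add_sq_le`). The objective is
coercive (`isBounded_sublevel_objective`), so the iterates are bounded.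

The decisive point is that the active components stay away from zero (`exists_pos_le_abs_inner`),
also when `τ = 0`. The optimality condition bounds a signed combination of the active `Gᵢ` with
weights `φ' |Gᵢᵀ xᵏ|`; pairing it with an iterate of the same sign pattern makes all contributions
positive, and there are only finitely many sign patterns, so all the weights are bounded. As `φ'`
is infinite at `0`, the components are bounded below.

Away from zero `φ'` is Lipschitz, so replacing the weights at `xᵏ` by those at `xᵏ⁺¹` costs only a
multiple of `‖xᵏ⁺¹ - xᵏ‖`. The infinite slope of `φ` at `0` makes the inactive terms an exact penalty
for the constraint (`mem_regularSubdiff_add_penalty`), so this produces regular subgradients of the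
objective itself (`weightCorrection_mem_regularSubdiff`), of size at most a multiple of the last
step. Sufficient decrease and this relative error bound are what the Kurdyka–Łojasiewicz argument
needs to show that the sequence has finite length and that its limit is stationary
(`exists_tendsto_stationary_of_descent`).
-/

/-! ### Limiting subgradients of constrained convex functions -/

section Subdiff

theorem add_indicatorFun_of_mem {X : Type*} {g : X → ℝ} {C : Set X} {z : X} (hz : z ∈ C) :
    (g z : EReal) + indicatorFun C z = g z := by
  simp [indicatorFun, hz]

theorem mem_of_add_indicatorFun_lt_top {X : Type*} {g : X → ℝ} {C : Set X} {z : X}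
    (hz : (g z : EReal) + indicatorFun C z < ⊤) : z ∈ C := by
  by_contra h
  simp [indicatorFun, h] at hz

variable {E : Type*} [NormedAddCommGroup E] [InnerProductSpace ℝ E]

theorem regularSubdiff_subset_limitingSubdiff (f : E → EReal) (y : E) :
    regularSubdiff f y ⊆ limitingSubdiff f y := fun v hv =>
  ⟨hv.1, fun _ => y, fun _ => v, tendsto_const_nhds, tendsto_const_nhds, fun _ => hv,
    tendsto_const_nhds⟩

theorem mem_regularSubdiff_coe {f : E → ℝ} {y v : E} :
    v ∈ regularSubdiff (fun z => (f z : EReal)) y ↔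
      ∀ ε : ℝ, 0 < ε → ∀ᶠ z in 𝓝 y, f y + (inner ℝ v (z - y) - ε * ‖z - y‖) ≤ f z := by
  simp only [regularSubdiff, mem_ofPred_eq, EReal.coe_lt_top, true_and, ← EReal.coe_add,
    EReal.coe_le_coe_iff]

theorem subgradient_of_mem_regularSubdiff {g : E → ℝ} (hg : ConvexOn ℝ univ g) {C : Set E}
    (hC : Convex ℝ C) {v y : E}
    (hv : v ∈ regularSubdiff (fun z => (g z : EReal) + indicatorFun C z) y) {z : E} (hz : z ∈ C) :
    g y + inner ℝ v (z - y) ≤ g z := by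
  obtain ⟨hy, hv⟩ := hv
  replace hy := mem_of_add_indicatorFun_lt_top hy
  refine le_of_forall_pos_le_add fun δ hδ => ?_
  have hn : 0 < ‖z - y‖ + 1 := by positivity
  set ε := δ / (‖z - y‖ + 1) with hε
  have hε0 : 0 < ε := by positivity
  have hεδ : ε * ‖z - y‖ ≤ δ := by
    have : ε * (‖z - y‖ + 1) = δ := div_mul_cancel₀ _ hn.ne'
    nlinarith
  have hlim : Tendsto (fun t : ℝ => y + t • (z - y)) (𝓝[>] 0) (𝓝 y) := by
    have : Continuous fun t : ℝ => y + t • (z - y) := by fun_prop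
    simpa using (this.tendsto 0).mono_left nhdsWithin_le_nhds
  have h1 : ∀ᶠ t : ℝ in 𝓝[>] 0, t < 1 :=
    nhdsWithin_le_nhds (Iio_mem_nhds one_pos)
  -- One short step along the segment is enough: convexity extends the inequality to `z`, up to
  -- the error `ε * ‖z - y‖ ≤ δ`.
  obtain ⟨t, ht, ht1, ht0⟩ :=
    ((hlim.eventually (hv ε hε0)).and (h1.and self_mem_nhdsWithin)).exists
  replace ht0 : 0 < t := ht0
  have hmem : y + t • (z - y) ∈ C := hC.add_smul_sub_mem hy hz ⟨ht0.le, ht1.le⟩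
  beta_reduce at ht
  rw [add_indicatorFun_of_mem hy, add_indicatorFun_of_mem hmem, ← EReal.coe_add,
    EReal.coe_le_coe_iff, add_sub_cancel_left, inner_smul_right, norm_smul,
    Real.norm_of_nonneg ht0.le] at ht
  have hcv := hg.2 (mem_univ y) (mem_univ z) (sub_nonneg.2 ht1.le) ht0.le (by ring)
  have he : (1 - t) • y + t • z = y + t • (z - y) := by module
  rw [he, smul_eq_mul, smul_eq_mul] at hcv
  have h2 : t * (g y + inner ℝ v (z - y) - ε * ‖z - y‖) ≤ t * g z := by nlinarith
  linarith [le_of_mul_le_mul_left h2 ht0]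

/-- For a continuous convex function restricted to a convex set, limiting subgradients are
subgradients in the sense of convex analysis. -/
theorem subgradient_of_mem_limitingSubdiff {g : E → ℝ} (hg : ConvexOn ℝ univ g)
    (hgc : Continuous g) {C : Set E} (hC : Convex ℝ C) {v y : E}
    (hv : v ∈ limitingSubdiff (fun z => (g z : EReal) + indicatorFun C z) y) :
    y ∈ C ∧ ∀ z ∈ C, g y + inner ℝ v (z - y) ≤ g z := by
  obtain ⟨hy, u, s, hu, -, hs, hsv⟩ := hv
  refine ⟨mem_of_add_indicatorFun_lt_top hy, fun z hz => ?_⟩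
  have hlim : Tendsto (fun k => g (u k) + inner ℝ (s k) (z - u k)) atTop
      (𝓝 (g y + inner ℝ v (z - y))) :=
    ((hgc.tendsto y).comp hu).add (hsv.inner (tendsto_const_nhds.sub hu))
  exact le_of_tendsto' hlim fun k => subgradient_of_mem_regularSubdiff hg hC (hs k) hz

end Subdiff

/-! ### Descent sequences of Kurdyka–Łojasiewicz functions -/

section KL

theorem le_tangent_of_concaveOn {S : Set ℝ} {f : ℝ → ℝ} (hf : ConcaveOn ℝ S f) {s t : ℝ}
    (hs : s ∈ S) (ht : t ∈ S) (hd : DifferentiableAt ℝ f s) :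
    f t ≤ f s + deriv f s * (t - s) := by
  rcases lt_trichotomy s t with h | rfl | h
  · have := hf.slope_le_deriv hs ht h hd
    rw [slope_def_field, div_le_iff₀ (sub_pos.2 h)] at this
    linarith
  · simp
  · have := hf.deriv_le_slope ht hs h hd
    rw [slope_def_field, le_div_iff₀ (sub_pos.2 h)] at this
    linarith

theorem two_mul_le_add_of_sq_le {a b c : ℝ} (hb : 0 ≤ b) (hc : 0 ≤ c)
    (h : a ^ 2 ≤ b * c) : 2 * a ≤ b + c := by
  nlinarith [sq_nonneg (b - c), sq_nonneg (b + c - 2 * a)]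

variable {E : Type*} [NormedAddCommGroup E]

/-- A sequence whose steps satisfy `2 dₖ₊₁ ≤ dₖ + pₖ - pₖ₊₁` as long as it stays in a ball, and
which starts deep enough inside this ball, never leaves it and has finite length. -/
theorem cauchySeq_of_local_step_bound {y : ℕ → E} {c : E} {δ D : ℝ} {p : ℕ → ℝ} {d : ℕ → ℝ}
    (hd : ∀ j, d (j + 1) = ‖y (j + 1) - y j‖) (hd0 : 0 ≤ d 0) (hp : ∀ j, 0 ≤ p j)
    (hD : d 0 + p 0 ≤ D) (hy0 : ‖y 0 - c‖ + D < δ)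
    (hstep : ∀ j, ‖y j - c‖ < δ → 2 * d (j + 1) ≤ d j + (p j - p (j + 1))) :
    CauchySeq y := by
  have hdn : ∀ j, 0 ≤ d j := by
    rintro (_ | j)
    · exact hd0
    · rw [hd]; positivity
  have hlen : ∀ j, ‖y j - y 0‖ ≤ ∑ i ∈ Finset.range j, d (i + 1) := fun j => by
    have := dist_le_range_sum_dist y j
    rw [dist_comm, dist_eq_norm] at this
    refine this.trans (Finset.sum_le_sum fun i _ => ?_)
    rw [hd, dist_comm, dist_eq_norm]
  -- Telescoping; the extra summand `d j` on the left absorbs the `d j` in the next step bound.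
  have key : ∀ j, ∑ i ∈ Finset.range j, d (i + 1) + d j ≤ d 0 + (p 0 - p j) := by
    intro j
    induction j with
    | zero => simp
    | succ j ih =>
      have hj : ‖y j - c‖ < δ := by
        have h1 := norm_sub_le_norm_sub_add_norm_sub (y j) (y 0) c
        linarith [hlen j, hdn j, hp j]
      rw [Finset.sum_range_succ]
      linarith [hstep j hj]
  have hsum : Summable fun j => d (j + 1) :=
    summable_of_sum_range_le (c := D) (fun j => hdn _) fun j => by
      linarith [key j, hdn j, hp j]
  refine cauchySeq_of_summable_dist (hsum.congr fun j => ?_)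
  rw [hd, dist_comm, dist_eq_norm]

variable [InnerProductSpace ℝ E] [FiniteDimensional ℝ E]

/-- Convergence of descent sequences of a Kurdyka–Łojasiewicz function: sufficient decrease and a
regular subgradient dominated by the last step force the whole bounded sequence to converge to a
stationary point. -/
theorem exists_tendsto_stationary_of_descent {f : E → ℝ} (hf : Continuous f)
    (hKL : IsKLFunction f) {x : ℕ → E} (hbdd : Bornology.IsBounded (range x)) {m C : ℝ}
    (hm : 0 < m) (hC : 0 < C)
    (hdec : ∀ k, f (x (k + 1)) + m * ‖x (k + 1) - x k‖ ^ 2 ≤ f (x k))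
    (hsub : ∀ k, ∃ v ∈ regularSubdiff (fun z => (f z : EReal)) (x (k + 1)),
      ‖v‖ ≤ C * ‖x (k + 1) - x k‖) :
    ∃ xstar, Tendsto x atTop (𝓝 xstar) ∧ IsStationaryPoint f xstar := by
  have hanti : Antitone fun k => f (x k) := antitone_nat_of_succ_le fun k => by
    have : 0 ≤ m * ‖x (k + 1) - x k‖ ^ 2 := by positivity
    linarith [hdec k]
  obtain ⟨c, -, σ, hσ, hσc⟩ := tendsto_subseq_of_bounded hbdd fun n => mem_range_self n
  have hfc : Tendsto (fun k => f (x k)) atTop (𝓝 (f c)) :=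
    (tendsto_iff_tendsto_subseq_of_antitone hanti hσ.tendsto_atTop).2 ((hf.tendsto c).comp hσc)
  have hd0 : Tendsto (fun k => ‖x (k + 1) - x k‖) atTop (𝓝 0) := by
    have h1 : Tendsto (fun k => (f (x k) - f (x (k + 1))) / m) atTop (𝓝 0) := by
      simpa using (hfc.sub (hfc.comp (tendsto_add_atTop_nat 1))).div_const m
    have h2 : Tendsto (fun k => ‖x (k + 1) - x k‖ ^ 2) atTop (𝓝 0) :=
      squeeze_zero (fun k => by positivity)
        (fun k => by rw [le_div_iff₀ hm]; linarith [hdec k]) h1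
    simpa using h2.sqrt
  choose v hv hvC using hsub
  have hv0 : Tendsto v atTop (𝓝 0) :=
    squeeze_zero_norm hvC (by simpa using hd0.const_mul C)
  -- The subsequence `x ∘ σ`, shifted by one step, still tends to `c`.
  have hσ1 : Tendsto (fun k => x (σ k + 1)) atTop (𝓝 c) := by
    have := (tendsto_zero_iff_norm_tendsto_zero.2 (hd0.comp hσ.tendsto_atTop)).add hσc
    simpa using this
  have hstat : IsStationaryPoint f c := by
    refine ⟨EReal.coe_lt_top _, fun k => x (σ k + 1), fun k => v (σ k), hσ1, ?_, fun k => hv _,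
      hv0.comp hσ.tendsto_atTop⟩
    exact (continuous_coe_real_ereal.tendsto _).comp ((hf.tendsto c).comp hσ1)
  suffices hcau : CauchySeq x by
    obtain ⟨a, ha⟩ := cauchySeq_tendsto_of_complete hcau
    obtain rfl := tendsto_nhds_unique (ha.comp hσ.tendsto_atTop) hσc
    exact ⟨a, ha, hstat⟩
  have hge : ∀ k, f c ≤ f (x k) := fun k => hanti.le_of_tendsto hfc k
  by_cases hex : ∃ n, f (x n) ≤ f c
  · -- Once the limit value is attained, the sequence is constant.
    obtain ⟨n, hn⟩ := hex
    have hconst : ∀ k, x (k + n) = x n := by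
      intro k
      induction k with
      | zero => simp
      | succ k ih =>
        have h1 := hdec (k + n)
        have h2 := hge (k + n + 1)
        have h3 : f (x (k + n)) ≤ f c := (hanti (by omega)).trans hn
        have h4 : ‖x (k + n + 1) - x (k + n)‖ ^ 2 ≤ 0 := by
          by_contra! h
          nlinarith [mul_pos hm h]
        have h5 : x (k + n + 1) - x (k + n) = 0 := by
          rw [← norm_eq_zero]
          exact (pow_eq_zero_iff two_ne_zero).1 (le_antisymm h4 (by positivity))
        rw [show k + 1 + n = k + n + 1 by ring, sub_eq_zero.1 h5, ih]
    refine (Tendsto.cauchySeq (x := x n) ?_)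
    rw [← tendsto_add_atTop_iff_nat n]
    exact tendsto_const_nhds.congr fun k => (hconst k).symm
  push Not at hex
  obtain ⟨η, U, ψ, hη, hU, hψc, hψconc, hψ0, hψn, hψd, hψpos, hineq⟩ := hKL.2 c ⟨0, hstat⟩
  obtain ⟨δ, hδ, hball⟩ := Metric.mem_nhds_iff.1 hU
  have ha0 : Tendsto (fun k => f (x k) - f c) atTop (𝓝 0) := by
    simpa using hfc.sub_const (f c)
  have hsmall : ∀ᶠ k in atTop, f (x k) - f c < η := ha0.eventually (gt_mem_nhds hη)
  have hψa : Tendsto (fun k => C / m * ψ (f (x k) - f c)) atTop (𝓝 0) := by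
    have h1 : Tendsto (fun k => f (x k) - f c) atTop (𝓝[Ico 0 η] 0) :=
      tendsto_nhdsWithin_iff.2 ⟨ha0, hsmall.mono fun k hk => ⟨sub_nonneg.2 (hge k), hk⟩⟩
    have h2 := ((hψc 0 ⟨le_rfl, hη⟩).tendsto.comp h1).const_mul (C / m)
    simpa [hψ0] using h2
  have hψa1 := hψa.comp (tendsto_add_atTop_nat 1)
  have hclose : ∀ᶠ k in atTop, ‖x (σ k + 1) - c‖ < δ / 2 := by
    have := (tendsto_iff_norm_sub_tendsto_zero.1 hσ1)
    exact this.eventually (gt_mem_nhds (half_pos hδ))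
  have hev : ∀ᶠ k in atTop, f (x k) - f c < η ∧
      ‖x (k + 1) - x k‖ + C / m * ψ (f (x (k + 1)) - f c) < δ / 2 := by
    refine hsmall.and ?_
    have : Tendsto (fun k => ‖x (k + 1) - x k‖ + C / m * ψ (f (x (k + 1)) - f c)) atTop (𝓝 0) := by
      simpa using hd0.add hψa1
    exact this.eventually (gt_mem_nhds (half_pos hδ))
  obtain ⟨j, ⟨hjη, hjD⟩, hjc⟩ := ((hσ.tendsto_atTop.eventually hev).and hclose).exists
  -- Start at `x (n + 1)`, which is close to `c`, with a short last step and a small value gap.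
  set n := σ j with hn
  have haη : ∀ k, n ≤ k → f (x k) - f c ∈ Ioo 0 η := fun k hk =>
    ⟨sub_pos.2 (hex k), lt_of_le_of_lt (sub_le_sub_right (hanti hk) _) hjη⟩
  have hCm : 0 < C / m := div_pos hC hm
  have hcau : CauchySeq fun k => x (k + (n + 1)) := by
    refine cauchySeq_of_local_step_bound (c := c) (δ := δ)
      (D := ‖x (n + 1) - x n‖ + C / m * ψ (f (x (n + 1)) - f c))
      (p := fun k => C / m * ψ (f (x (k + (n + 1))) - f c))
      (d := fun k => ‖x (k + n + 1) - x (k + n)‖) ?_ ?_ ?_ ?_ ?_ ?_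
    · intro k
      rw [show k + 1 + n = k + (n + 1) by omega, show k + 1 + (n + 1) = k + (n + 1) + 1 by omega]
    · positivity
    · intro k
      exact mul_nonneg hCm.le (hψn _ (Ioo_subset_Ico_self (haη _ (by omega))))
    · simp
    · simp only [zero_add]; linarith
    · intro k hk
      have hxU : x (k + (n + 1)) ∈ U := hball (by rwa [Metric.mem_ball, dist_eq_norm])
      have hk1 := haη (k + (n + 1)) (by omega)
      have hk2 := haη (k + (n + 1) + 1) (by omega)
      have hkl := hineq _ hxU (hex _) (by linarith [hk1.2]) (v (k + n))
        (regularSubdiff_subset_limitingSubdiff _ _ (hv (k + n)))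
      have hdiff : DifferentiableAt ℝ ψ (f (x (k + (n + 1))) - f c) :=
        (hψd.differentiableOn one_ne_zero).differentiableAt (Ioo_mem_nhds hk1.1 hk1.2)
      have htan := le_tangent_of_concaveOn hψconc (Ioo_subset_Ico_self hk1)
        (Ioo_subset_Ico_self hk2) hdiff
      have hpos := hψpos _ hk1
      have hvb := hvC (k + n)
      have hde := hdec (k + (n + 1))
      rw [show k + 1 + n + 1 = k + (n + 1) + 1 by ring, show k + 1 + n = k + (n + 1) by ring,
        show k + 1 + (n + 1) = k + (n + 1) + 1 by ring]
      rw [show k + n + 1 = k + (n + 1) by ring] at hvb ⊢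
      set g := deriv ψ (f (x (k + (n + 1))) - f c)
      set d1 := ‖x (k + (n + 1) + 1) - x (k + (n + 1))‖
      set d0 := ‖x (k + (n + 1)) - x (k + n)‖
      set a := f (x (k + (n + 1)))
      set a' := f (x (k + (n + 1) + 1))
      have hd0n : 0 ≤ d0 := norm_nonneg _
      -- Concavity of `ψ` turns the decrease of `f` into a decrease of `ψ (f - f c)`; the
      -- Kurdyka–Łojasiewicz inequality bounds its slope `g` below by `1 / (C * d0)`.
      have hψdrop : g * (m * d1 ^ 2) ≤ ψ (a - f c) - ψ (a' - f c) := by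
        have : g * (m * d1 ^ 2) ≤ g * (a - a') := mul_le_mul_of_nonneg_left (by linarith) hpos.le
        linarith
      have hg1 : 1 ≤ g * (C * d0) := hkl.trans (mul_le_mul_of_nonneg_left hvb hpos.le)
      have hsq : d1 ^ 2 ≤ d0 * (C / m * (ψ (a - f c) - ψ (a' - f c))) := by
        have h1 : m * d1 ^ 2 * 1 ≤ m * d1 ^ 2 * (g * (C * d0)) :=
          mul_le_mul_of_nonneg_left hg1 (by positivity)
        have h2 : C * d0 * (g * (m * d1 ^ 2)) ≤ C * d0 * (ψ (a - f c) - ψ (a' - f c)) :=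
          mul_le_mul_of_nonneg_left hψdrop (by positivity)
        have h3 : d0 * (C / m * (ψ (a - f c) - ψ (a' - f c)))
            = C * d0 * (ψ (a - f c) - ψ (a' - f c)) / m := by ring
        rw [h3, le_div_iff₀ hm]
        linarith
      have := two_mul_le_add_of_sq_le hd0n
        (mul_nonneg hCm.le ((by positivity : (0:ℝ) ≤ g * (m * d1 ^ 2)).trans hψdrop)) hsq
      linarith
  obtain ⟨a, ha⟩ := cauchySeq_tendsto_of_complete hcau
  exact ((tendsto_add_atTop_iff_nat (n + 1)).1 ha).cauchySeq

end KL

/-! ### Exact penalization of a linear constraint -/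

section Penalty

variable {E F : Type*} [NormedAddCommGroup E] [InnerProductSpace ℝ E] [FiniteDimensional ℝ E]
  [NormedAddCommGroup F] [NormedSpace ℝ F]

/-- The distance to the kernel of a linear map is controlled by the norm of the image. -/
theorem exists_norm_sub_starProjection_ker_le (L : E →ₗ[ℝ] F) :
    ∃ K : ℝ, 0 ≤ K ∧ ∀ z, ‖z - L.ker.starProjection z‖ ≤ K * ‖L z‖ := by
  have hinj : (L.domRestrict L.kerᗮ).ker = ⊥ := by
    rw [LinearMap.ker_eq_bot']
    rintro ⟨w, hw⟩ h0
    have hw0 : w ∈ L.ker := h0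
    have : w = 0 := by
      have := Submodule.inner_right_of_mem_orthogonal hw0 hw
      exact inner_self_eq_zero.1 this
    simp [this]
  obtain ⟨K, -, hK⟩ := (L.domRestrict L.kerᗮ).exists_antilipschitzWith hinj
  refine ⟨K, K.2, fun z => ?_⟩
  have h := hK.le_mul_norm (map_zero _) ⟨_, L.ker.sub_starProjection_mem_orthogonal z⟩
  have h0 : L (L.ker.starProjection z) = 0 := L.ker.starProjection_apply_mem z
  simpa [h0] using h

/-- Exact penalization: a regular subgradient of `g` relative to the subspace `ker L` is one of
`g + P` on the whole space when the penalty `P` grows faster than any multiple of `‖L z‖`. -/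
theorem mem_regularSubdiff_add_penalty {g P : E → ℝ} (L : E →ₗ[ℝ] F) {x v : E} (hx : L x = 0)
    {K : NNReal} {t : Set E} (ht : t ∈ 𝓝 x) (hg : LipschitzOnWith K g t) (hPx : P x = 0)
    (hP : ∀ c : ℝ, ∀ᶠ z in 𝓝 x, c * ‖L z‖ ≤ P z)
    (hv : ∀ ε : ℝ, 0 < ε → ∀ᶠ z in 𝓝 x, L z = 0 →
      g x + (inner ℝ v (z - x) - ε * ‖z - x‖) ≤ g z) :
    v ∈ regularSubdiff (fun z => ((g z + P z : ℝ) : EReal)) x := by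
  rw [mem_regularSubdiff_coe]
  intro ε hε
  obtain ⟨B, hB, hdist⟩ := exists_norm_sub_starProjection_ker_le L
  set π := L.ker.starProjection with hπ
  have hπx : π x = x := Submodule.starProjection_eq_self_iff.2 hx
  have hπc : Tendsto π (𝓝 x) (𝓝 x) := by simpa [hπx] using π.continuous.tendsto x
  -- Compare `z` with its projection `π z`: the loss is Lipschitz in `‖z - π z‖`, which the penalty
  -- with the factor `(K + ‖v‖) * B` compensates.
  filter_upwards [hπc.eventually (hv ε hε), hP ((K + ‖v‖) * B), ht, hπc ht] with z h1 h2 h3 h4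
  have h1 := h1 (L.ker.starProjection_apply_mem z)
  have h5 : |g z - g (π z)| ≤ K * ‖z - π z‖ := by
    simpa [dist_eq_norm] using hg.dist_le_mul z h3 (π z) h4
  have h6 : inner ℝ v (z - x) ≤ inner ℝ v (π z - x) + ‖v‖ * ‖z - π z‖ := by
    have : z - x = (π z - x) + (z - π z) := by abel
    rw [this, inner_add_right]
    linarith [real_inner_le_norm v (z - π z)]
  have h7 : ‖π z - x‖ ≤ ‖z - x‖ := by
    have := L.ker.norm_starProjection_apply_le (z - x)
    rwa [map_sub, ← hπ, hπx] at this
  have h8 : (K + ‖v‖) * ‖z - π z‖ ≤ (K + ‖v‖) * B * ‖L z‖ := by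
    rw [mul_assoc]
    exact mul_le_mul_of_nonneg_left (hdist z) (by positivity)
  have h9 := mul_le_mul_of_nonneg_left h7 hε.le
  have h10 := neg_le_of_abs_le h5
  rw [hPx]
  linarith

end Penalty

/-! ### The potential function -/

section Potential

variable {φ : ℝ → ℝ}

theorem ITSS.IsPotential.contDiffAt (hφ : IsPotential φ) {t : ℝ} (ht : 0 < t) :
    ContDiffAt ℝ 1 φ t :=
  hφ.contDiffOn.contDiffAt (Ioi_mem_nhds ht)

theorem ITSS.IsPotential.differentiableAt (hφ : IsPotential φ) {t : ℝ} (ht : 0 < t) :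
    DifferentiableAt ℝ φ t :=
  (hφ.contDiffAt ht).differentiableAt one_ne_zero

theorem ITSS.IsPotential.le_tangent (hφ : IsPotential φ) {s t : ℝ} (hs : 0 < s) (ht : 0 ≤ t) :
    φ t ≤ φ s + deriv φ s * (t - s) :=
  le_tangent_of_concaveOn hφ.concaveOn hs.le ht (hφ.differentiableAt hs)

theorem ITSS.IsPotential.exists_lt_deriv (hφ : IsPotential φ) (D : ℝ) :
    ∃ θ : ℝ, 0 < θ ∧ ∀ t, 0 < t → t < θ → D < deriv φ t := by
  have h := hφ.deriv_zero_right.eventually (eventually_gt_atTop D)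
  obtain ⟨θ, hθ, h⟩ := mem_nhdsGT_iff_exists_Ioo_subset.1 h
  exact ⟨θ, hθ, fun t h0 h1 => h ⟨h0, h1⟩⟩

/-- Near `0` the potential dominates every linear function, since its slope there is infinite. -/
theorem ITSS.IsPotential.exists_mul_le (hφ : IsPotential φ) (D : ℝ) :
    ∃ θ : ℝ, 0 < θ ∧ ∀ t, 0 ≤ t → t < θ → D * t ≤ φ t := by
  obtain ⟨θ, hθ, h⟩ := hφ.exists_lt_deriv D
  refine ⟨θ, hθ, fun t h0 h1 => ?_⟩
  rcases h0.eq_or_lt with rfl | h0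
  · simp [hφ.map_zero]
  · have := hφ.le_tangent h0 le_rfl
    rw [hφ.map_zero] at this
    nlinarith [h t h0 h1]

theorem ITSS.IsPotential.continuous_comp_abs (hφ : IsPotential φ) :
    Continuous fun t : ℝ => φ |t| :=
  hφ.continuousOn.comp_continuous continuous_abs fun t => abs_nonneg t

end Potential

/-! ### The fidelity term -/

section Fidelity

variable {M N : ℕ} {A : Matrix (Fin M) (Fin N) ℝ} {b : EuclideanSpace ℝ (Fin M)} {β q : ℝ}

theorem fidelity_nonneg (hβ : 0 < β) (hq : 1 ≤ q) (x : EuclideanSpace ℝ (Fin N)) :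
    0 ≤ fidelity A b β q x := by
  have : 0 < q := by linarith
  unfold fidelity
  positivity

theorem convexOn_abs_rpow (hq : 1 ≤ q) : ConvexOn ℝ univ fun t : ℝ => |t| ^ q := by
  refine ⟨convex_univ, fun s _ t _ a c ha hc hac => ?_⟩
  have h1 : |a • s + c • t| ≤ a • |s| + c • |t| := by
    simp only [smul_eq_mul]
    calc |a * s + c * t| ≤ |a * s| + |c * t| := abs_add_le _ _
      _ = a * |s| + c * |t| := by rw [abs_mul, abs_mul, abs_of_nonneg ha, abs_of_nonneg hc]
  exact (Real.rpow_le_rpow (abs_nonneg _) h1 (by linarith)).trans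
    ((convexOn_rpow hq).2 (abs_nonneg s) (abs_nonneg t) ha hc hac)

theorem convexOn_fidelity (hβ : 0 < β) (hq : 1 ≤ q) :
    ConvexOn ℝ univ (fidelity A b β q : EuclideanSpace ℝ (Fin N) → ℝ) := by
  refine ⟨convex_univ, fun x _ y _ a c ha hc hac => ?_⟩
  have hq0 : 0 < q := by linarith
  have h : ∀ l, |A.mulVec (a • x + c • y).ofLp l - b l| ^ q
      ≤ a * |A.mulVec x.ofLp l - b l| ^ q + c * |A.mulVec y.ofLp l - b l| ^ q := fun l => by
    have h1 := (convexOn_abs_rpow hq).2 (mem_univ (A.mulVec x.ofLp l - b l))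
      (mem_univ (A.mulVec y.ofLp l - b l)) ha hc hac
    simp only [smul_eq_mul] at h1
    convert! h1 using 3
    simp only [WithLp.ofLp_add, WithLp.ofLp_smul, Matrix.mulVec_add, Matrix.mulVec_smul,
      Pi.add_apply, Pi.smul_apply, smul_eq_mul]
    linear_combination (b l) * hac
  simp only [fidelity, smul_eq_mul]
  calc β / q * ∑ l, |A.mulVec (a • x + c • y).ofLp l - b l| ^ q
      ≤ β / q * ∑ l, (a * |A.mulVec x.ofLp l - b l| ^ q + c * |A.mulVec y.ofLp l - b l| ^ q) :=
        mul_le_mul_of_nonneg_left (Finset.sum_le_sum fun l _ => h l) (by positivity)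
    _ = _ := by rw [Finset.sum_add_distrib, ← Finset.mul_sum, ← Finset.mul_sum]; ring

theorem continuous_fidelity (hβ : 0 < β) (hq : 1 ≤ q) :
    Continuous (fidelity A b β q : EuclideanSpace ℝ (Fin N) → ℝ) :=
  (convexOn_fidelity hβ hq).locallyLipschitz.continuous

end Fidelity

/-! ### The objective and its linearization -/

section Objective

variable {M N : ℕ} {J : Type*} [Fintype J] {φ : ℝ → ℝ} {G : J → EuclideanSpace ℝ (Fin N)}
  {A : Matrix (Fin M) (Fin N) ℝ} {b : EuclideanSpace ℝ (Fin M)} {β q ρ τ ε : ℝ}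

theorem continuous_objective (hφ : IsPotential φ) (hβ : 0 < β) (hq : 1 ≤ q) :
    Continuous (objective φ G A b β q) := by
  refine Continuous.add (continuous_finsetSum _ fun i _ => ?_) (continuous_fidelity hβ hq)
  exact hφ.continuous_comp_abs.comp (by fun_prop : Continuous fun x => inner ℝ (G i) x)

/-- The sublevel sets of the objective are bounded: both kinds of terms control the linear forms
inside them, and jointly these separate points. -/
theorem isBounded_sublevel_objective (hφ : IsPotential φ)
    (hAG : ∀ x : EuclideanSpace ℝ (Fin N),
      A.mulVec x.ofLp = 0 → (∀ i, inner ℝ (G i) x = 0) → x = 0)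
    (hβ : 0 < β) (hq : 1 ≤ q) (B : ℝ) :
    Bornology.IsBounded {x | objective φ G A b β q x ≤ B} := by
  have hq0 : 0 < q := by linarith
  let L1 : EuclideanSpace ℝ (Fin N) →ₗ[ℝ] (Fin M → ℝ) :=
    A.mulVecLin ∘ₗ (WithLp.linearEquiv 2 ℝ (Fin N → ℝ)).toLinearMap
  let L2 : EuclideanSpace ℝ (Fin N) →ₗ[ℝ] (J → ℝ) := LinearMap.pi fun i => innerₛₗ ℝ (G i)
  have hL1 : ∀ x, L1 x = A.mulVec x.ofLp := fun x => rfl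
  have hL2 : ∀ x i, L2 x i = inner ℝ (G i) x := fun x i => rfl
  have hker : (L1.prod L2).ker = ⊥ := by
    rw [LinearMap.ker_eq_bot']
    intro x hx
    have h := Prod.ext_iff.1 hx
    exact hAG x h.1 fun i => congrFun h.2 i
  obtain ⟨K, -, hK⟩ := (L1.prod L2).exists_antilipschitzWith hker
  obtain ⟨R, hR⟩ := eventually_atTop.1 (hφ.coercive.eventually (eventually_gt_atTop B))
  -- `R1` bounds `‖A x‖`, through `t ≤ 1 + t ^ q`.
  set R1 := 1 + B / (β / q) + ‖b.ofLp‖ with hR1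
  rw [isBounded_iff_forall_norm_le]
  refine ⟨K * max R1 (max R 0), fun x hx => ?_⟩
  have hφn : ∀ i, 0 ≤ φ |inner ℝ (G i) x| := fun i => hφ.nonneg _ (abs_nonneg _)
  have hsum : ∑ i, φ |inner ℝ (G i) x| + fidelity A b β q x ≤ B := hx
  have hfid : fidelity A b β q x ≤ B := by
    linarith [Finset.sum_nonneg fun i (_ : i ∈ Finset.univ) => hφn i]
  have h2 : ‖L2 x‖ ≤ max R 0 := by
    refine (pi_norm_le_iff_of_nonneg (le_max_right _ _)).2 fun i => ?_
    rw [hL2, Real.norm_eq_abs]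
    by_contra! hlt
    have h1 := hR _ ((le_max_left R 0).trans hlt.le)
    have h3 := Finset.single_le_sum (fun i _ => hφn i) (Finset.mem_univ i)
    linarith [fidelity_nonneg (A := A) (b := b) hβ hq x]
  have hβq : 0 < β / q := by positivity
  have h1 : ‖L1 x‖ ≤ R1 := by
    have hB : 0 ≤ B := (fidelity_nonneg hβ hq x).trans hfid
    refine (pi_norm_le_iff_of_nonneg (by positivity)).2 fun l => ?_
    rw [hL1, Real.norm_eq_abs]
    have h4 : |A.mulVec x.ofLp l - b l| ^ q ≤ B / (β / q) := by
      rw [le_div_iff₀ hβq, mul_comm]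
      refine (mul_le_mul_of_nonneg_left ?_ hβq.le).trans hfid
      exact Finset.single_le_sum (f := fun l => |A.mulVec x.ofLp l - b l| ^ q)
        (fun l _ => by positivity) (Finset.mem_univ l)
    have h5 : |A.mulVec x.ofLp l - b l| ≤ 1 + |A.mulVec x.ofLp l - b l| ^ q := by
      rcases le_total |A.mulVec x.ofLp l - b l| 1 with h | h
      · have : 0 ≤ |A.mulVec x.ofLp l - b l| ^ q := by positivity
        linarith
      · linarith [Real.self_le_rpow_of_one_le h hq]
    have h6 : |b l| ≤ ‖b.ofLp‖ := norm_le_pi_norm b.ofLp l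
    have h7 := abs_sub_abs_le_abs_sub (A.mulVec x.ofLp l) (b l)
    rw [hR1]
    linarith
  calc ‖x‖ ≤ K * ‖(L1.prod L2) x‖ := hK.le_mul_norm (map_zero _) x
    _ ≤ K * max R1 (max R 0) := by
      refine mul_le_mul_of_nonneg_left ?_ K.2
      exact max_le_max h1 h2

theorem mem_tauSupport {y : EuclideanSpace ℝ (Fin N)} {i : J} :
    i ∈ tauSupport G τ y ↔ τ < |inner ℝ (G i) y| := by
  simp [tauSupport]

theorem abs_inner_pos_of_mem_tauSupport (hτ : 0 ≤ τ) {y : EuclideanSpace ℝ (Fin N)} {i : J}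
    (hi : i ∈ tauSupport G τ y) : 0 < |inner ℝ (G i) y| :=
  hτ.trans_lt (mem_tauSupport.1 hi)

theorem convex_constraintSet (y : EuclideanSpace ℝ (Fin N)) :
    Convex ℝ (constraintSet G τ y) := by
  intro u hu w hw a c _ _ _ i hi
  rw [inner_add_right, inner_smul_right, inner_smul_right, hu i hi, hw i hi]
  simp

/-- The objective is the sum over any index set outside of which all `Gᵢᵀ z` vanish. -/
theorem objective_eq_sum_of_support (hφ : IsPotential φ) {T : Finset J}
    {z : EuclideanSpace ℝ (Fin N)} (hz : ∀ i, i ∉ T → inner ℝ (G i) z = 0) :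
    objective φ G A b β q z = ∑ i ∈ T, φ |inner ℝ (G i) z| + fidelity A b β q z := by
  unfold objective
  rw [Finset.sum_subset (Finset.subset_univ T) fun i _ hi => by simp [hz i hi, hφ.map_zero]]

theorem convexOn_linearized (hφ : IsPotential φ) (hβ : 0 < β) (hq : 1 ≤ q) (hρ : 0 < ρ)
    (hτ : 0 ≤ τ) (y : EuclideanSpace ℝ (Fin N)) :
    ConvexOn ℝ univ (linearized φ G A b β q ρ τ y) := by
  refine ((ConvexOn.add ?_ (convexOn_fidelity hβ hq))).add ?_
  · refine ⟨convex_univ, fun u _ w _ a c ha hc hac => ?_⟩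
    simp only [smul_eq_mul, Finset.mul_sum, ← Finset.sum_add_distrib]
    refine Finset.sum_le_sum fun i hi => ?_
    have hd := (hφ.deriv_pos _ (abs_inner_pos_of_mem_tauSupport hτ hi)).le
    have h1 : |inner ℝ (G i) (a • u + c • w)|
        ≤ a * |inner ℝ (G i) u| + c * |inner ℝ (G i) w| := by
      rw [inner_add_right, inner_smul_right, inner_smul_right]
      refine (abs_add_le _ _).trans_eq ?_
      rw [abs_mul, abs_mul, abs_of_nonneg ha, abs_of_nonneg hc]
    have h2 := mul_le_mul_of_nonneg_left h1 hd
    set p := φ |inner ℝ (G i) y|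
    set D := deriv φ |inner ℝ (G i) y|
    set n := |inner ℝ (G i) y|
    calc p + D * (|inner ℝ (G i) (a • u + c • w)| - n)
        ≤ p + (D * (a * |inner ℝ (G i) u| + c * |inner ℝ (G i) w|) - D * n) := by linarith
      _ = a * (p + D * (|inner ℝ (G i) u| - n)) + c * (p + D * (|inner ℝ (G i) w| - n)) := by
        linear_combination (D * n - p) * hac
  · have h : ConvexOn ℝ univ fun z => ‖z - y‖ ^ 2 := by
      refine ConvexOn.pow (f := fun z => ‖z - y‖) ?_ (fun z _ => norm_nonneg _) 2
      have := (convexOn_univ_norm (E := EuclideanSpace ℝ (Fin N))).translate_left (-y)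
      simpa [Function.comp_def, sub_eq_add_neg] using this
    exact h.smul (by positivity : 0 ≤ ρ / 2)

theorem continuous_linearized (hφ : IsPotential φ) (hβ : 0 < β) (hq : 1 ≤ q) (hρ : 0 < ρ)
    (hτ : 0 ≤ τ) (y : EuclideanSpace ℝ (Fin N)) :
    Continuous (linearized φ G A b β q ρ τ y) :=
  (convexOn_linearized hφ hβ hq hρ hτ y).locallyLipschitz.continuous

/-- The linearization majorizes the objective on the constraint subspace, with a proximal gap. -/
theorem objective_add_le_linearized (hφ : IsPotential φ) (hτ : 0 ≤ τ)
    {y z : EuclideanSpace ℝ (Fin N)} (hz : z ∈ constraintSet G τ y) :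
    objective φ G A b β q z + ρ / 2 * ‖z - y‖ ^ 2 ≤ linearized φ G A b β q ρ τ y z := by
  rw [objective_eq_sum_of_support hφ hz, linearized]
  gcongr with i hi
  exact hφ.le_tangent (abs_inner_pos_of_mem_tauSupport hτ hi) (abs_nonneg _)

theorem linearized_self (hφ : IsPotential φ) {y : EuclideanSpace ℝ (Fin N)}
    (hy : y ∈ constraintSet G τ y) :
    linearized φ G A b β q ρ τ y y = objective φ G A b β q y := by
  rw [objective_eq_sum_of_support hφ hy, linearized]
  simp

/-- Sufficient decrease of the objective along an inexact step from a point whose small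
components already vanish. -/
theorem objective_add_sq_le (hφ : IsPotential φ) (hτ : 0 ≤ τ)
    {y z h : EuclideanSpace ℝ (Fin N)} (hy : y ∈ constraintSet G τ y)
    (hz : z ∈ constraintSet G τ y)
    (hsub : ∀ w ∈ constraintSet G τ y,
      linearized φ G A b β q ρ τ y z + inner ℝ h (w - z) ≤ linearized φ G A b β q ρ τ y w)
    (hh : ‖h‖ ≤ ρ / 2 * ε * ‖z - y‖) :
    objective φ G A b β q z + ρ / 2 * (1 - ε) * ‖z - y‖ ^ 2 ≤ objective φ G A b β q y := by
  have h1 := hsub y hy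
  rw [linearized_self hφ hy] at h1
  have h2 := objective_add_le_linearized (A := A) (b := b) (β := β) (q := q) (ρ := ρ) hφ hτ hz
  have h3 := neg_le_of_abs_le (abs_real_inner_le_norm h (y - z))
  rw [norm_sub_rev y z] at h3
  have h4 := mul_le_mul_of_nonneg_right hh (norm_nonneg (z - y))
  nlinarith

/-- Testing the optimality condition of a step against a direction `w` along which all active
components shrink bounds the weights of the linearization. -/
theorem sum_deriv_mul_abs_inner_le (hβ : 0 < β) (hq : 1 ≤ q) (hρ : 0 < ρ)
    {y z w h : EuclideanSpace ℝ (Fin N)}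
    (hz : z ∈ constraintSet G τ y) (hw : w ∈ constraintSet G τ y)
    (hsub : ∀ u ∈ constraintSet G τ y,
      linearized φ G A b β q ρ τ y z + inner ℝ h (u - z) ≤ linearized φ G A b β q ρ τ y u)
    (hsign : ∀ i ∈ tauSupport G τ y, 0 < inner ℝ (G i) z * inner ℝ (G i) w) :
    ∑ i ∈ tauSupport G τ y, deriv φ |inner ℝ (G i) y| * |inner ℝ (G i) w|
      ≤ inner ℝ h w + (fidelity A b β q (z - w) - fidelity A b β q z)
        + ρ / 2 * (‖z - w - y‖ ^ 2 - ‖z - y‖ ^ 2) := by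
  have hev : ∀ᶠ t : ℝ in 𝓝[>] 0, ∀ i ∈ tauSupport G τ y,
      t * |inner ℝ (G i) w| < |inner ℝ (G i) z| := by
    rw [Filter.eventually_all_finset]
    intro i hi
    have hpos : 0 < |inner ℝ (G i) z| := abs_pos.2 (left_ne_zero_of_mul (hsign i hi).ne')
    have : Tendsto (fun t : ℝ => t * |inner ℝ (G i) w|) (𝓝[>] 0) (𝓝 0) := by
      have h : Continuous fun t : ℝ => t * |inner ℝ (G i) w| := by fun_prop
      simpa using (h.tendsto 0).mono_left nhdsWithin_le_nhds
    exact this.eventually (gt_mem_nhds hpos)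
  have h1 : ∀ᶠ t : ℝ in 𝓝[>] 0, t < 1 := nhdsWithin_le_nhds (Iio_mem_nhds one_pos)
  obtain ⟨t, ht, ht1, ht0⟩ := (hev.and (h1.and self_mem_nhdsWithin)).exists
  replace ht0 : 0 < t := ht0
  have hu : z - t • w ∈ constraintSet G τ y := fun i hi => by
    rw [inner_sub_right, inner_smul_right, hz i hi, hw i hi]; simp
  have habs : ∀ i ∈ tauSupport G τ y,
      |inner ℝ (G i) (z - t • w)| = |inner ℝ (G i) z| - t * |inner ℝ (G i) w| := fun i hi => by
    have h2 := ht i hi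
    have h3 := hsign i hi
    rw [inner_sub_right, inner_smul_right]
    rcases pos_and_pos_or_neg_and_neg_of_mul_pos h3 with ⟨ha, hb⟩ | ⟨ha, hb⟩
    · rw [abs_of_pos ha, abs_of_pos hb] at *
      rw [abs_of_pos (by linarith)]
    · rw [abs_of_neg ha, abs_of_neg hb] at *
      rw [abs_of_neg (by linarith)]
      ring
  have hs := hsub _ hu
  simp only [linearized] at hs
  have hsumeq : ∑ i ∈ tauSupport G τ y, (φ |inner ℝ (G i) y| +
        deriv φ |inner ℝ (G i) y| * (|inner ℝ (G i) (z - t • w)| - |inner ℝ (G i) y|))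
      = ∑ i ∈ tauSupport G τ y, (φ |inner ℝ (G i) y| +
        deriv φ |inner ℝ (G i) y| * (|inner ℝ (G i) z| - |inner ℝ (G i) y|))
        - t * ∑ i ∈ tauSupport G τ y, deriv φ |inner ℝ (G i) y| * |inner ℝ (G i) w| := by
    rw [Finset.mul_sum, ← Finset.sum_sub_distrib]
    refine Finset.sum_congr rfl fun i hi => ?_
    rw [habs i hi]
    ring
  have hfid : fidelity A b β q (z - t • w)
      ≤ fidelity A b β q z + t * (fidelity A b β q (z - w) - fidelity A b β q z) := by
    have := (convexOn_fidelity (A := A) (b := b) hβ hq).2 (mem_univ z) (mem_univ (z - w))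
      (sub_nonneg.2 ht1.le) ht0.le (by ring)
    rw [show (1 - t) • z + t • (z - w) = z - t • w by module] at this
    simp only [smul_eq_mul] at this
    linarith
  have hnorm : ‖z - t • w - y‖ ^ 2 ≤ ‖z - y‖ ^ 2 + t * (‖z - w - y‖ ^ 2 - ‖z - y‖ ^ 2) := by
    have e1 : z - t • w - y = (z - y) - t • w := by abel
    have e2 : z - w - y = (z - y) - w := by abel
    rw [e1, e2, norm_sub_sq_real (z - y) (t • w), norm_sub_sq_real (z - y) w,
      inner_smul_right, norm_smul, Real.norm_of_nonneg ht0.le]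
    nlinarith [mul_nonneg (mul_nonneg ht0.le (sub_nonneg.2 ht1.le)) (sq_nonneg ‖w‖)]
  rw [hsumeq, sub_sub_cancel_left, inner_neg_right, inner_smul_right] at hs
  have hnorm' := mul_le_mul_of_nonneg_left hnorm (by positivity : 0 ≤ ρ / 2)
  refine le_of_mul_le_mul_left ?_ ht0
  linarith

end Objective

/-! ### Lower bound on the active components -/

section LowerBound

/-- If each iterate has one of finitely many sign patterns, then finitely many iterates represent
all of them, so that representatives can be chosen with entries bounded away from zero. -/
theorem exists_uniform_sign_witness {J : Type*} [Fintype J] (a : ℕ → J → ℝ) {T : Finset J}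
    (ha : ∀ k, ∀ i ∈ T, a k i ≠ 0) :
    ∃ c : ℝ, 0 < c ∧ ∀ k, ∃ j, ∀ i ∈ T, 0 < a k i * a j i ∧ c ≤ |a j i| := by
  classical
  have hone : ∀ j, ∃ c : ℝ, 0 < c ∧ ∀ i ∈ T, c ≤ |a j i| := fun j => by
    have h : ∀ᶠ c : ℝ in 𝓝[>] 0, ∀ i ∈ T, c < |a j i| := by
      rw [Filter.eventually_all_finset]
      exact fun i hi => nhdsWithin_le_nhds (Iio_mem_nhds (abs_pos.2 (ha j i hi)))
    obtain ⟨c, hc, hc0⟩ := (h.and self_mem_nhdsWithin).exists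
    exact ⟨c, hc0, fun i hi => (hc i hi).le⟩
  have hpat : ∀ p : J → SignType, ∃ c : ℝ, 0 < c ∧
      ((∃ j, ∀ i, SignType.sign (a j i) = p i) →
        ∃ j, (∀ i, SignType.sign (a j i) = p i) ∧ ∀ i ∈ T, c ≤ |a j i|) := fun p => by
    by_cases h : ∃ j, ∀ i, SignType.sign (a j i) = p i
    · obtain ⟨j, hj⟩ := h
      obtain ⟨c, hc, hcj⟩ := hone j
      exact ⟨c, hc, fun _ => ⟨j, hj, hcj⟩⟩
    · exact ⟨1, one_pos, fun h' => absurd h' h⟩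
  choose c hc hcp using hpat
  obtain ⟨p0, -, hmin⟩ := Finset.exists_min_image Finset.univ c Finset.univ_nonempty
  refine ⟨c p0, hc p0, fun k => ?_⟩
  obtain ⟨j, hj, hcj⟩ := hcp (fun i => SignType.sign (a k i)) ⟨k, fun _ => rfl⟩
  refine ⟨j, fun i hi => ⟨?_, (hmin _ (Finset.mem_univ _)).trans (hcj i hi)⟩⟩
  have hs := hj i
  rcases (ha k i hi).lt_or_gt with h | h
  · rw [sign_neg h, sign_eq_neg_one_iff] at hs
    exact mul_pos_of_neg_of_neg h hs
  · rw [sign_pos h, sign_eq_one_iff] at hs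
    exact mul_pos h hs

variable {M N : ℕ} {J : Type*} [Fintype J] {φ : ℝ → ℝ} {G : J → EuclideanSpace ℝ (Fin N)}
  {A : Matrix (Fin M) (Fin N) ℝ} {b : EuclideanSpace ℝ (Fin M)} {β q ρ τ ε : ℝ}

/-- Once the support is stationary, the active components stay away from zero: the weights of the
linearization are bounded by the optimality conditions, while `φ'` is infinite at `0`. -/
theorem exists_pos_le_abs_inner (hφ : IsPotential φ) (hβ : 0 < β) (hq : 1 ≤ q) (hρ : 0 < ρ)
    (hτ : 0 ≤ τ) (hε0 : 0 < ε) {T : Finset J} {x h : ℕ → EuclideanSpace ℝ (Fin N)}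
    (hbdd : Bornology.IsBounded (range x)) (hT : ∀ k, tauSupport G τ (x k) = T)
    (hmem : ∀ k j, x k ∈ constraintSet G τ (x j))
    (hsub : ∀ k, ∀ u ∈ constraintSet G τ (x k),
      linearized φ G A b β q ρ τ (x k) (x (k + 1)) + inner ℝ (h k) (u - x (k + 1))
        ≤ linearized φ G A b β q ρ τ (x k) u)
    (hh : ∀ k, ‖h k‖ ≤ ρ / 2 * ε * ‖x (k + 1) - x k‖) :
    ∃ θ : ℝ, 0 < θ ∧ ∀ k, ∀ i ∈ T, θ ≤ |inner ℝ (G i) (x k)| := by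
  have hpos : ∀ k, ∀ i ∈ T, 0 < |inner ℝ (G i) (x k)| := fun k i hi =>
    abs_inner_pos_of_mem_tauSupport hτ (by rwa [hT])
  obtain ⟨R, hR⟩ := isBounded_iff_forall_norm_le.1 hbdd
  replace hR : ∀ k, ‖x k‖ ≤ R := fun k => hR _ (mem_range_self k)
  have hR0 : 0 ≤ R := (norm_nonneg _).trans (hR 0)
  obtain ⟨Q, hQ⟩ := ((isCompact_closedBall (0 : EuclideanSpace ℝ (Fin N)) (R + R)).image
    (continuous_fidelity (A := A) (b := b) hβ hq)).bddAbove
  have hQ : ∀ z, ‖z‖ ≤ R + R → fidelity A b β q z ≤ Q := fun z hz =>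
    hQ (mem_image_of_mem _ (mem_closedBall_zero_iff.2 hz))
  obtain ⟨c, hc, hw⟩ := exists_uniform_sign_witness (fun k i => inner ℝ (G i) (x k))
    (fun k i hi => abs_pos.1 (hpos k i hi))
  set B := ρ / 2 * ε * (R + R) * R + Q + ρ / 2 * (R + R + R) ^ 2 with hB
  obtain ⟨θ, hθ, hθφ⟩ := hφ.exists_lt_deriv (B / c)
  refine ⟨θ, hθ, fun k i hi => ?_⟩
  -- Test with an earlier or later iterate `x j` that has the sign pattern of `x (k + 1)`.
  by_contra! hlt
  have hbig := hθφ _ (hpos k i hi) hlt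
  obtain ⟨j, hj⟩ := hw (k + 1)
  have hxx : ‖x (k + 1) - x k‖ ≤ R + R := (norm_sub_le _ _).trans (add_le_add (hR _) (hR _))
  have hxj : ‖x (k + 1) - x j‖ ≤ R + R := (norm_sub_le _ _).trans (add_le_add (hR _) (hR _))
  have hxjk : ‖x (k + 1) - x j - x k‖ ≤ R + R + R := (norm_sub_le _ _).trans
    (add_le_add hxj (hR _))
  have hmain := sum_deriv_mul_abs_inner_le hβ hq hρ (hmem (k + 1) k) (hmem j k) (hsub k)
    (fun i hi => (hj i (by rwa [hT] at hi)).1)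
  have hinner : inner ℝ (h k) (x j) ≤ ρ / 2 * ε * (R + R) * R := by
    refine (real_inner_le_norm _ _).trans (mul_le_mul ?_ (hR j) (norm_nonneg _) (by positivity))
    exact (hh k).trans (mul_le_mul_of_nonneg_left hxx (by positivity))
  have hsq : ρ / 2 * (‖x (k + 1) - x j - x k‖ ^ 2 - ‖x (k + 1) - x k‖ ^ 2)
      ≤ ρ / 2 * (R + R + R) ^ 2 := by
    refine mul_le_mul_of_nonneg_left ?_ (by positivity)
    have := pow_le_pow_left₀ (norm_nonneg _) hxjk 2
    linarith [sq_nonneg ‖x (k + 1) - x k‖]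
  have hle : deriv φ |inner ℝ (G i) (x k)| * |inner ℝ (G i) (x j)| ≤ B := by
    rw [hT] at hmain
    have h1 := Finset.single_le_sum
      (f := fun i => deriv φ |inner ℝ (G i) (x k)| * |inner ℝ (G i) (x j)|)
      (fun i hi => mul_nonneg (hφ.deriv_pos _ (hpos k i hi)).le (abs_nonneg _)) hi
    linarith [hQ _ hxj, fidelity_nonneg (A := A) (b := b) hβ hq (x (k + 1))]
  have h2 : deriv φ |inner ℝ (G i) (x k)| * c
      ≤ deriv φ |inner ℝ (G i) (x k)| * |inner ℝ (G i) (x j)| :=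
    mul_le_mul_of_nonneg_left (hj i hi).2 (hφ.deriv_pos _ (hpos k i hi)).le
  rw [div_lt_iff₀ hc] at hbig
  linarith

end LowerBound

/-! ### Subgradients of the objective at the iterates -/

section ActiveTerms

variable {M N : ℕ} {J : Type*} {φ : ℝ → ℝ} {G : J → EuclideanSpace ℝ (Fin N)}
  {A : Matrix (Fin M) (Fin N) ℝ} {b : EuclideanSpace ℝ (Fin M)} {β q : ℝ}

theorem hasFDerivAt_comp_abs_inner {f : ℝ → ℝ} {g x : EuclideanSpace ℝ (Fin N)}
    (hx : inner ℝ g x ≠ 0) (hf : DifferentiableAt ℝ f |inner ℝ g x|) :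
    HasFDerivAt (fun z => f |inner ℝ g z|)
      (innerSL ℝ ((deriv f |inner ℝ g x| * (SignType.sign (inner ℝ g x) : ℝ)) • g)) x := by
  have h1 : HasDerivAt (fun t : ℝ => f |t|) _ (inner ℝ g x) :=
    hf.hasDerivAt.comp (inner ℝ g x) (hasDerivAt_abs hx)
  have h2 : HasFDerivAt (fun z => inner ℝ g z) (innerSL ℝ g) x := (innerSL ℝ g).hasFDerivAt
  convert! h1.comp_hasFDerivAt x h2 using 1
  ext z
  simp

/-- The correction that turns a subgradient of the linearized subproblem into one of the
objective: the change of the weights of the active terms, minus the proximal gradient. -/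
noncomputable def weightCorrection (φ : ℝ → ℝ) (G : J → EuclideanSpace ℝ (Fin N)) (ρ : ℝ)
    (T : Finset J) (y x : EuclideanSpace ℝ (Fin N)) : EuclideanSpace ℝ (Fin N) :=
  ∑ i ∈ T, ((deriv φ |inner ℝ (G i) x| - deriv φ |inner ℝ (G i) y|) *
    (SignType.sign (inner ℝ (G i) x) : ℝ)) • G i - ρ • (x - y)

theorem exists_lipschitzOnWith_active (hφ : IsPotential φ) (hβ : 0 < β) (hq : 1 ≤ q)
    {T : Finset J} {x : EuclideanSpace ℝ (Fin N)} (hxT : ∀ i ∈ T, inner ℝ (G i) x ≠ 0) :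
    ∃ (K : NNReal), ∃ t ∈ 𝓝 x, LipschitzOnWith K
      (fun z => ∑ i ∈ T, φ |inner ℝ (G i) z| + fidelity A b β q z) t := by
  have h1 : ContDiffAt ℝ 1 (fun z => ∑ i ∈ T, φ |inner ℝ (G i) z|) x := by
    refine ContDiffAt.sum fun i hi => ?_
    have ha : ContDiffAt ℝ 1 (fun t : ℝ => φ |t|) (inner ℝ (G i) x) :=
      (hφ.contDiffAt (abs_pos.2 (hxT i hi))).comp _ (contDiffAt_abs (hxT i hi))
    exact ha.comp (f := fun z => inner ℝ (G i) z) x (innerSL ℝ (G i)).contDiff.contDiffAt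
  obtain ⟨K1, t1, ht1, hK1⟩ := h1.exists_lipschitzOnWith
  obtain ⟨K2, t2, ht2, hK2⟩ := (convexOn_fidelity (A := A) (b := b) hβ hq).locallyLipschitz x
  exact ⟨K1 + K2, t1 ∩ t2, inter_mem ht1 ht2,
    (hK1.mono inter_subset_left).add (hK2.mono inter_subset_right)⟩

end ActiveTerms

section Subgradient

variable {M N : ℕ} {J : Type*} [Fintype J] {φ : ℝ → ℝ} {G : J → EuclideanSpace ℝ (Fin N)}
  {A : Matrix (Fin M) (Fin N) ℝ} {b : EuclideanSpace ℝ (Fin M)} {β q ρ τ : ℝ}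

/-- On the active components the objective and its linearization differ by a function which is
differentiable at every point where these do not vanish. The nonsmooth parts of the fidelity term
cancel. -/
theorem hasFDerivAt_sub_linearized (hφ : IsPotential φ) {y x : EuclideanSpace ℝ (Fin N)}
    (hxT : ∀ i ∈ tauSupport G τ y, inner ℝ (G i) x ≠ 0) :
    HasFDerivAt (fun z => (∑ i ∈ tauSupport G τ y, φ |inner ℝ (G i) z| + fidelity A b β q z)
        - linearized φ G A b β q ρ τ y z)
      (innerSL ℝ (weightCorrection φ G ρ (tauSupport G τ y) y x)) x := by
  have h1 : HasFDerivAt (fun z => ∑ i ∈ tauSupport G τ y,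
      (fun t => φ t - (φ |inner ℝ (G i) y| + deriv φ |inner ℝ (G i) y| *
        (t - |inner ℝ (G i) y|))) |inner ℝ (G i) z|)
      (∑ i ∈ tauSupport G τ y, innerSL ℝ (((deriv φ |inner ℝ (G i) x|
        - deriv φ |inner ℝ (G i) y|) * (SignType.sign (inner ℝ (G i) x) : ℝ)) • G i)) x := by
    refine HasFDerivAt.fun_sum fun i hi => ?_
    have hd : HasDerivAt (fun t => φ t - (φ |inner ℝ (G i) y| + deriv φ |inner ℝ (G i) y| *
        (t - |inner ℝ (G i) y|))) (deriv φ |inner ℝ (G i) x| - deriv φ |inner ℝ (G i) y|)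
        |inner ℝ (G i) x| := by
      have ha := (hφ.differentiableAt (abs_pos.2 (hxT i hi))).hasDerivAt
      have hb := ((((hasDerivAt_id |inner ℝ (G i) x|).sub_const |inner ℝ (G i) y|).const_mul
        (deriv φ |inner ℝ (G i) y|)).const_add (φ |inner ℝ (G i) y|))
      convert! ha.sub hb using 1
      simp
    have := hasFDerivAt_comp_abs_inner (hxT i hi) hd.differentiableAt
    rwa [hd.deriv] at this
  have h2 : HasFDerivAt (fun z => ρ / 2 * ‖z - y‖ ^ 2) (innerSL ℝ (ρ • (x - y))) x := by
    have := ((hasFDerivAt_id (𝕜 := ℝ) x).sub_const y).norm_sq.const_mul (ρ / 2)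
    convert! this using 1
    ext z
    simp
    ring
  have h3 := h1.sub h2
  convert! h3 using 1
  · ext z
    simp only [Pi.sub_apply, linearized, Finset.sum_sub_distrib]
    ring
  · rw [weightCorrection, map_sub, map_sum]

/-- Transfer of optimality: a subgradient of the linearized subproblem, corrected by the change of
the weights, is a regular subgradient of the objective. No multipliers for the constraint are
needed, because the inactive terms of the objective, of infinite slope at `0`, act as an exact
penalty. -/
theorem weightCorrection_mem_regularSubdiff (hφ : IsPotential φ) (hβ : 0 < β) (hq : 1 ≤ q)
    {y x h : EuclideanSpace ℝ (Fin N)} (hx : x ∈ constraintSet G τ y)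
    (hxT : ∀ i ∈ tauSupport G τ y, inner ℝ (G i) x ≠ 0)
    (hsub : ∀ u ∈ constraintSet G τ y,
      linearized φ G A b β q ρ τ y x + inner ℝ h (u - x) ≤ linearized φ G A b β q ρ τ y u) :
    h + weightCorrection φ G ρ (tauSupport G τ y) y x
      ∈ regularSubdiff (fun z => (objective φ G A b β q z : EReal)) x := by
  classical
  set T := tauSupport G τ y with hT
  let L : EuclideanSpace ℝ (Fin N) →ₗ[ℝ] ({i // i ∉ T} → ℝ) :=
    LinearMap.pi fun i => innerₛₗ ℝ (G i)
  have hL0 : ∀ z, L z = 0 → z ∈ constraintSet G τ y := fun z hz i hi => congrFun hz ⟨i, hi⟩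
  obtain ⟨K, t, ht, hLip⟩ := exists_lipschitzOnWith_active (A := A) (b := b) hφ hβ hq hxT
  have hobj : ∀ z, objective φ G A b β q z
      = (∑ i ∈ T, φ |inner ℝ (G i) z| + fidelity A b β q z)
        + ∑ i : {i // i ∉ T}, φ |inner ℝ (G i) z| := fun z => by
    rw [objective, ← Finset.sum_add_sum_compl T,
      Finset.sum_subtype Tᶜ (p := fun i => i ∉ T) fun _ => Finset.mem_compl]
    ring
  simp only [hobj]
  refine mem_regularSubdiff_add_penalty L (funext fun i => hx i i.2) ht hLip ?_ ?_ ?_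
  · exact Finset.sum_eq_zero fun i _ => by rw [hx i i.2, abs_zero, hφ.map_zero]
  · intro c
    obtain ⟨θ, hθ, hφθ⟩ := hφ.exists_mul_le (max c 0)
    have hnear : ∀ᶠ z in 𝓝 x, ∀ i : {i // i ∉ T}, |inner ℝ (G i) z| < θ := by
      rw [eventually_all]
      intro i
      have hc : Continuous fun z => |inner ℝ (G i) z| := by fun_prop
      refine (hc.tendsto x).eventually (gt_mem_nhds ?_)
      rwa [hx i i.2, abs_zero]
    filter_upwards [hnear] with z hz
    have hn : ‖L z‖ ≤ ∑ i : {i // i ∉ T}, |inner ℝ (G i) z| :=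
      (pi_norm_le_iff_of_nonneg (Finset.sum_nonneg fun _ _ => abs_nonneg _)).2 fun i =>
        Finset.single_le_sum (f := fun i : {i // i ∉ T} => |inner ℝ (G i) z|)
          (fun _ _ => abs_nonneg _) (Finset.mem_univ i)
    calc c * ‖L z‖ ≤ max c 0 * ‖L z‖ :=
          mul_le_mul_of_nonneg_right (le_max_left _ _) (norm_nonneg _)
      _ ≤ max c 0 * ∑ i : {i // i ∉ T}, |inner ℝ (G i) z| :=
          mul_le_mul_of_nonneg_left hn (le_max_right _ _)
      _ ≤ ∑ i : {i // i ∉ T}, φ |inner ℝ (G i) z| := by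
          rw [Finset.mul_sum]
          exact Finset.sum_le_sum fun i _ => hφθ _ (abs_nonneg _) (hz i)
  · intro δ hδ
    have hd := (hasFDerivAt_sub_linearized (A := A) (b := b) (β := β) (q := q) (ρ := ρ)
      hφ hxT).isLittleO.bound hδ
    filter_upwards [hd] with z hz hLz
    have h1 := hsub z (hL0 z hLz)
    have h2 := neg_le_of_abs_le hz
    rw [innerSL_apply_apply] at h2
    rw [inner_add_left]
    linarith

theorem norm_weightCorrection_le {T : Finset J} {y x : EuclideanSpace ℝ (Fin N)} {θ Λ : ℝ}
    (hρ : 0 < ρ) (hx : ∀ i ∈ T, θ ≤ |inner ℝ (G i) x|) (hy : ∀ i ∈ T, θ ≤ |inner ℝ (G i) y|)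
    (hΛ0 : 0 ≤ Λ)
    (hΛ : ∀ t s, θ ≤ t → θ ≤ s → |deriv φ t - deriv φ s| ≤ Λ * |t - s|) :
    ‖weightCorrection φ G ρ T y x‖ ≤ (Λ * ∑ i, ‖G i‖ ^ 2 + ρ) * ‖x - y‖ := by
  have hterm : ∀ i ∈ T, ‖((deriv φ |inner ℝ (G i) x| - deriv φ |inner ℝ (G i) y|) *
      (SignType.sign (inner ℝ (G i) x) : ℝ)) • G i‖ ≤ Λ * ‖G i‖ ^ 2 * ‖x - y‖ := fun i hi => by
    have hs : |(SignType.sign (inner ℝ (G i) x) : ℝ)| ≤ 1 := by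
      rcases SignType.sign (inner ℝ (G i) x) with _ | _ | _ <;> simp
    have h1 := hΛ _ _ (hx i hi) (hy i hi)
    have h2 : |(|inner ℝ (G i) x| - |inner ℝ (G i) y|)| ≤ ‖G i‖ * ‖x - y‖ := by
      refine (abs_abs_sub_abs_le_abs_sub _ _).trans ?_
      rw [← inner_sub_right]
      exact abs_real_inner_le_norm _ _
    rw [norm_smul, Real.norm_eq_abs, abs_mul]
    calc |(deriv φ |inner ℝ (G i) x| - deriv φ |inner ℝ (G i) y|)|
          * |(SignType.sign (inner ℝ (G i) x) : ℝ)| * ‖G i‖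
        ≤ (Λ * (‖G i‖ * ‖x - y‖)) * 1 * ‖G i‖ := by
          gcongr
          exact h1.trans (mul_le_mul_of_nonneg_left h2 hΛ0)
      _ = Λ * ‖G i‖ ^ 2 * ‖x - y‖ := by ring
  calc ‖weightCorrection φ G ρ T y x‖
      ≤ ∑ i ∈ T, Λ * ‖G i‖ ^ 2 * ‖x - y‖ + ‖ρ • (x - y)‖ :=
        (norm_sub_le _ _).trans (add_le_add (norm_sum_le_of_le _ hterm) le_rfl)
    _ ≤ ∑ i, Λ * ‖G i‖ ^ 2 * ‖x - y‖ + ρ * ‖x - y‖ := by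
        rw [norm_smul, Real.norm_of_nonneg hρ.le]
        gcongr
        exact Finset.subset_univ T
    _ = _ := by rw [← Finset.sum_mul, ← Finset.mul_sum]; ring

end Subgradient

/-! ### Convergence of the iterates -/

theorem theorem3p5 {M N : ℕ} {J : Type*} [Fintype J]
    (φ : ℝ → ℝ) (hφ : IsPotential φ)
    (G : J → EuclideanSpace ℝ (Fin N)) (A : Matrix (Fin M) (Fin N) ℝ)
    (hAG : ∀ x : EuclideanSpace ℝ (Fin N),
      A.mulVec x.ofLp = 0 → (∀ i, inner ℝ (G i) x = 0) → x = 0)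
    (b : EuclideanSpace ℝ (Fin M)) (β q ρ τ ε : ℝ)
    (hβ : 0 < β) (hq : 1 ≤ q) (hρ : 0 < ρ) (hτ : 0 ≤ τ) (hε0 : 0 < ε) (hε1 : ε < 1)
    (hKL : IsKLFunction (objective φ G A b β q))
    (x : ℕ → EuclideanSpace ℝ (Fin N))
    (hx : IsInexactITSSPL φ G A b β q ρ τ ε x) :
    ∃ xstar : EuclideanSpace ℝ (Fin N),
      Tendsto x atTop (𝓝 xstar) ∧ IsStationaryPoint (objective φ G A b β q) xstar := by
  choose h hsub hh using hx
  have hconv : ∀ k, x (k + 1) ∈ constraintSet G τ (x k) ∧ ∀ u ∈ constraintSet G τ (x k),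
      linearized φ G A b β q ρ τ (x k) (x (k + 1)) + inner ℝ (h k) (u - x (k + 1))
        ≤ linearized φ G A b β q ρ τ (x k) u := fun k =>
    subgradient_of_mem_limitingSubdiff (convexOn_linearized hφ hβ hq hρ hτ _)
      (continuous_linearized hφ hβ hq hρ hτ _) (convex_constraintSet _) (hsub k)
  -- The supports shrink, hence are eventually constant.
  have hanti : ∀ k, tauSupport G τ (x (k + 1)) ⊆ tauSupport G τ (x k) := fun k i hi => by
    by_contra hni
    have := abs_inner_pos_of_mem_tauSupport hτ hi
    rw [(hconv k).1 i hni, abs_zero] at this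
    exact this.false
  obtain ⟨n, hn⟩ := WellFoundedGT.monotone_chain_condition
    (⟨fun k => OrderDual.toDual (tauSupport G τ (x k)), monotone_nat_of_le_succ hanti⟩ :
      ℕ →o (Finset J)ᵒᵈ)
  set T := tauSupport G τ (x n) with hT
  replace hn : ∀ k, n ≤ k → tauSupport G τ (x k) = T := fun k hk => (hn k hk).symm
  -- From index `n + 1` on, every iterate lies in the constraint subspace of every other one; the
  -- iterate `x n` itself may still have inactive components below the threshold.
  set z : ℕ → EuclideanSpace ℝ (Fin N) := fun k => x (k + (n + 1)) with hz
  set g : ℕ → EuclideanSpace ℝ (Fin N) := fun k => h (k + (n + 1)) with hg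
  have hz1 : ∀ k, z (k + 1) = x (k + (n + 1) + 1) := fun k => by
    simp only [hz, show k + 1 + (n + 1) = k + (n + 1) + 1 by ring]
  have hzT : ∀ k, tauSupport G τ (z k) = T := fun k => hn _ (by omega)
  have hmem : ∀ k j, z k ∈ constraintSet G τ (z j) := fun k j i hi => by
    refine (hconv (k + n)).1 i ?_
    rwa [hn _ (by omega), ← hzT j]
  have hzsub : ∀ k, ∀ u ∈ constraintSet G τ (z k),
      linearized φ G A b β q ρ τ (z k) (z (k + 1)) + inner ℝ (g k) (u - z (k + 1))
        ≤ linearized φ G A b β q ρ τ (z k) u := fun k => by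
    rw [hz1]; exact (hconv (k + (n + 1))).2
  have hgn : ∀ k, ‖g k‖ ≤ ρ / 2 * ε * ‖z (k + 1) - z k‖ := fun k => by
    rw [hz1]; exact hh (k + (n + 1))
  have hdec : ∀ k, objective φ G A b β q (z (k + 1))
      + ρ / 2 * (1 - ε) * ‖z (k + 1) - z k‖ ^ 2 ≤ objective φ G A b β q (z k) := fun k =>
    objective_add_sq_le hφ hτ (hmem k k) (hmem (k + 1) k) (hzsub k) (hgn k)
  have hm : 0 < ρ / 2 * (1 - ε) := mul_pos (by positivity) (by linarith)
  have hbdd : Bornology.IsBounded (range z) := by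
    refine (isBounded_sublevel_objective (b := b) hφ hAG hβ hq
      (objective φ G A b β q (z 0))).subset ?_
    rintro _ ⟨k, rfl⟩
    refine (antitone_nat_of_succ_le (f := fun k => objective φ G A b β q (z k))
      fun k => ?_) (Nat.zero_le k)
    have : 0 ≤ ρ / 2 * (1 - ε) * ‖z (k + 1) - z k‖ ^ 2 := by positivity
    linarith [hdec k]
  obtain ⟨θ, hθ, hzθ⟩ := exists_pos_le_abs_inner hφ hβ hq hρ hτ hε0 hbdd hzT hmem hzsub hgn
  obtain ⟨Λ, hΛ⟩ := hφ.deriv_lipschitz θ hθ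
  have hΛ' : ∀ t s, θ ≤ t → θ ≤ s → |deriv φ t - deriv φ s| ≤ max Λ 0 * |t - s| :=
    fun t s ht hs => (hΛ t s ht hs).trans
      (mul_le_mul_of_nonneg_right (le_max_left _ _) (abs_nonneg _))
  have hC : 0 < ρ / 2 * ε + (max Λ 0 * ∑ i, ‖G i‖ ^ 2 + ρ) := by positivity
  obtain ⟨xstar, hlim, hstat⟩ := exists_tendsto_stationary_of_descent
    (continuous_objective hφ hβ hq) hKL hbdd hm hC hdec fun k =>
      ⟨g k + weightCorrection φ G ρ (tauSupport G τ (z k)) (z k) (z (k + 1)),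
        weightCorrection_mem_regularSubdiff hφ hβ hq (hmem (k + 1) k)
          (fun i hi => abs_pos.1 (hθ.trans_le (hzθ (k + 1) i (by rwa [hzT] at hi)))) (hzsub k), by
        rw [hzT, add_mul]
        exact (norm_add_le _ _).trans (add_le_add (hgn k)
          (norm_weightCorrection_le hρ (hzθ (k + 1)) (hzθ k) (le_max_right _ _) hΛ'))⟩
  exact ⟨xstar, (tendsto_add_atTop_iff_nat (n + 1)).1 hlim, hstat⟩
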